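/- Let $r\ge 1$, let $X=\mathbb P^{n_1}\times\cdots\times\mathbb P^{n_r}$ with Cox ring variables $V=\{x_{i,j} : 1\le i\le r,\ 0\le j\le n_i\}$ and irrelevant ideal $B_X=\bigcap_{i=1}^r\langle x_{i,0},\dots,x_{i,n_i}\rangle$, and let $\mathcal B_X$ be the simplicial complex on $V$ whose Stanley--Reisner ideal is $B_X$; that is, $F\subseteq V$ lies in $\mathcal B_X$ if and only if, for some $i$, $F$ contains none of $x_{i,0},\dots,x_{i,n_i}$. Here a simplicial complex on a finite set $V$ is a family of subsets of $V$ closed under taking subsets, $\dim F=|F|-1$, and a face $F$ of a complex $\Delta$ on $V$ is called relevant if $F\notin\mathcal B_X$. The complex $\Delta$ is relevant-connected if any two relevant faces $F,G$ of $\Delta$ are joined by a finite sequence $F=K_0,K_1,\dots,K_m=G$ of relevant faces of $\Delta$ with every $K_{t}\cap K_{t+1}$ relevant. Let $\Delta$ be a relevant-connected simplicial complex on $V$, pure of dimension $r$, all of whose facets are relevant, and suppose that the relative simplicial homology group $H_r(\Delta,\Delta\cap\mathcal B_X;\mathbb Z)$ is $0$. Then $\Delta$ is virtually shellable; that is, the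 facets of $\Delta$ can be ordered $F_1\prec\cdots\prec F_N$ (each listed once) so that there are a simplicial complex $\Delta'$ on a finite set $V'$ and a map $\psi:V'\to V$ that sends faces of $\Delta'$ to faces of $\Delta$, such that every face of $\Delta$ is the image of a face of $\Delta'$, and, writing $\psi^{-1}(F)=\{G\in\Delta' : \psi(G)=F\}$ for $F\in\Delta$: 1. $|\psi^{-1}(F_i)|=1$ for all $i$, and the single elements $G_1,\dots,G_N$ of these fibers form a shelling of $\Delta'$: $\Delta'$ is pure, $G_1,\dots,G_N$ are its facets (each listed once), and for $1\le i<N$ the complex $\langle G_{i+1}\rangle\cap\langle G_1,\dots,G_i\rangle$ is pure of dimension $\dim G_{i+1}-1$; 2. $\dim\psi(G)=\dim G$ for all $G\in\Delta'$; 3. $\{F\in\Delta : |\psi^{-1}(F)|>1\}\subseteq\mathcal B_X$. -/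

import Mathlib

namespace VirtualShelling

section Complexes

/-- A simplicial complex on a vertex set `V`: a set of finite subsets of `V` closed under taking
subsets. The empty set is allowed as a face (it has dimension `-1`), and not every element of `V`
has to be a face. The subcomplex `⟨F⟩` of all subsets of `F` is `LowerSet.Iic F`. -/
abbrev SimplicialComplex (V : Type*) := LowerSet (Finset V)

variable {V : Type*}

/-- The dimension `|F| - 1` of a simplex. -/
def dim (F : Finset V) : ℤ := (F.card : ℤ) - 1

/-- Facets are the faces that are maximal under inclusion. -/
def IsFacet (Δ : SimplicialComplex V) (F : Finset V) : Prop := Maximal (· ∈ Δ) F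

/-- All facets have the same dimension. -/
def IsPure (Δ : SimplicialComplex V) : Prop :=
  ∀ F G : Finset V, IsFacet Δ F → IsFacet Δ G → dim F = dim G

/-- `Δ` is pure of dimension `d`: it has a face (so that its dimension makes sense) and every facet
has dimension `d`. -/
def IsPureOfDim (Δ : SimplicialComplex V) (d : ℤ) : Prop :=
  (∃ F, F ∈ Δ) ∧ ∀ F, IsFacet Δ F → dim F = d

/-- `F` lists the facets of `Δ`, each exactly once: it is an ordering of the facets. -/
def IsFacetOrdering (Δ : SimplicialComplex V) {N : ℕ} (F : Fin N → Finset V) : Prop :=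
  Function.Injective F ∧ Set.range F = {G | IsFacet Δ G}

/-- The ordering `F` of the facets of the pure complex `Δ` is a shelling: every facet but the first
meets the complex generated by the earlier ones in a pure complex of codimension one. -/
def IsShelling (Δ : SimplicialComplex V) {N : ℕ} (F : Fin N → Finset V) : Prop :=
  IsPure Δ ∧ IsFacetOrdering Δ F ∧
    ∀ i : Fin N, (∃ j, j < i) →
      IsPureOfDim (LowerSet.Iic (F i) ⊓ ⨆ j : {j : Fin N // j < i}, LowerSet.Iic (F j))
        (dim (F i) - 1)

/-- The set `ψ⁻¹(F)` of the faces of `Δ'` that the vertex map `ψ` sends onto `F`. -/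
def fiber {V' : Type*} [DecidableEq V] (Δ' : SimplicialComplex V') (ψ : V' → V) (F : Finset V) :
    Set (Finset V') :=
  {G | G ∈ Δ' ∧ G.image ψ = F}

/-- The vertex map `ψ` is a simplicial map from `Δ'` to `Δ` which is surjective on faces. -/
def IsSurjectiveSimplicialMap {V' : Type*} [DecidableEq V] (Δ' : SimplicialComplex V')
    (Δ : SimplicialComplex V) (ψ : V' → V) : Prop :=
  (∀ G ∈ Δ', G.image ψ ∈ Δ) ∧ ∀ F ∈ Δ, (fiber Δ' ψ F).Nonempty

/-- The ordering `F` of the facets of `Δ` is a virtual shelling order relative to the complex `B` of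
irrelevant simplices: there are a complex `Δ'` on a finite vertex set and a surjective simplicial
map `ψ : Δ' → Δ` that preserves dimensions of faces, whose fibers with more than one element lie
over `B`, whose fibers over facets have exactly one element, and such that
`ψ⁻¹(F 0), ψ⁻¹(F 1), …` (that is, the single elements `G 0, G 1, …` of these fibers) is a shelling
of `Δ'`. -/
def IsVirtualShellingOrder [DecidableEq V] (B Δ : SimplicialComplex V) {N : ℕ} (F : Fin N → Finset V) :
    Prop :=
  IsFacetOrdering Δ F ∧
    ∃ (V' : Type) (_ : Finite V') (Δ' : SimplicialComplex V') (ψ : V' → V),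
      IsSurjectiveSimplicialMap Δ' Δ ψ ∧
      (∃ G : Fin N → Finset V', (∀ i, G i ∈ fiber Δ' ψ (F i)) ∧ IsShelling Δ' G) ∧
      (∀ G ∈ Δ', dim (G.image ψ) = dim G) ∧
      {K | K ∈ Δ ∧ 1 < (fiber Δ' ψ K).encard} ⊆ (B : Set (Finset V)) ∧
      ∀ i, (fiber Δ' ψ (F i)).encard = 1

/-- `Δ` is virtually shellable, relative to the complex `B` of irrelevant simplices. -/
def IsVirtuallyShellable [DecidableEq V] (B Δ : SimplicialComplex V) : Prop :=
  ∃ (N : ℕ) (F : Fin N → Finset V), IsVirtualShellingOrder B Δ F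

/-- A face of `Δ` is relevant if it does not lie in the complex `B` of irrelevant simplices. -/
def IsRelevantFace (B Δ : SimplicialComplex V) (F : Finset V) : Prop := F ∈ Δ ∧ F ∉ B

/-- `Δ` is relevant-connected: any two relevant faces are joined by a finite sequence of relevant
faces in which the intersection of any two consecutive ones is relevant. -/
def RelevantConnected [DecidableEq V] (B Δ : SimplicialComplex V) : Prop :=
  ∀ F G : Finset V, IsRelevantFace B Δ F → IsRelevantFace B Δ G →
    Relation.ReflTransGen
      (fun K L => IsRelevantFace B Δ K ∧ IsRelevantFace B Δ L ∧ IsRelevantFace B Δ (K ∩ L)) F G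

end Complexes

section Homology

variable {V : Type*} [LinearOrder V]

/-- The simplicial boundary operator with integer coefficients, every simplex being oriented by the
linear order on `V`: the face `F \ {v}` of `F` has the sign `(-1) ^ p`, where `p` is the position of
`v` in `F`. A vertex has the empty simplex as its boundary (augmented chains). -/
noncomputable def boundary : (Finset V →₀ ℤ) →ₗ[ℤ] (Finset V →₀ ℤ) :=
  Finsupp.linearCombination ℤ fun F =>
    ∑ v ∈ F, (-1 : ℤ) ^ (F.filter (· < v)).card • Finsupp.single (F.erase v) (1 : ℤ)

/-- The group of `k`-chains of `Δ`, free on the `k`-dimensional faces. -/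
noncomputable def chains (Δ : SimplicialComplex V) (k : ℕ) : Submodule ℤ (Finset V →₀ ℤ) :=
  Finsupp.supported ℤ ℤ {F | F ∈ Δ ∧ dim F = k}

/-- Relative `k`-cycles of the pair `(Δ, Δ ∩ B)`: the chains of `Δ` whose boundary lies in `B`. -/
noncomputable def relCycles (Δ B : SimplicialComplex V) (k : ℕ) : Submodule ℤ (Finset V →₀ ℤ) :=
  chains Δ k ⊓ (Finsupp.supported ℤ ℤ {F | F ∈ Δ ⊓ B}).comap boundary

/-- Relative `k`-boundaries of the pair `(Δ, Δ ∩ B)`: boundaries of `(k+1)`-chains of `Δ`, modulo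
`k`-chains of `Δ ∩ B`. -/
noncomputable def relBoundaries (Δ B : SimplicialComplex V) (k : ℕ) : Submodule ℤ (Finset V →₀ ℤ) :=
  (chains Δ (k + 1)).map boundary ⊔ chains (Δ ⊓ B) k

/-- The relative simplicial homology group `H_k(Δ, B; ℤ)`, that is, the homology of the pair
`(Δ, Δ ∩ B)`. As soon as the empty simplex belongs to `B`, augmented and ordinary chains give the
same relative chain complex. -/
abbrev RelHomology (Δ B : SimplicialComplex V) (k : ℕ) : Type _ :=
  relCycles Δ B k ⧸ (relBoundaries Δ B k).submoduleOf (relCycles Δ B k)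

theorem boundary_single (F : Finset V) : boundary (Finsupp.single F (1 : ℤ)) =
    ∑ v ∈ F, (-1 : ℤ) ^ (F.filter (· < v)).card • Finsupp.single (F.erase v) (1 : ℤ) := by
  simp [boundary]

theorem boundary_boundary (c : Finset V →₀ ℤ) : boundary (boundary c) = 0 := by
  suffices h : boundary ∘ₗ boundary = (0 : (Finset V →₀ ℤ) →ₗ[ℤ] (Finset V →₀ ℤ)) from
    LinearMap.congr_fun h c
  ext1 F
  ext1
  simp only [LinearMap.comp_apply, Finsupp.lsingle_apply, LinearMap.zero_apply]
  rw [boundary_single, map_sum]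
  simp only [map_smul, boundary_single, Finset.smul_sum, smul_smul]
  rw [Finset.sum_sigma']
  have key : ∀ v w : V, v ∈ F → w ∈ F → v < w →
      (-1 : ℤ) ^ (F.filter (· < v)).card * (-1) ^ ((F.erase v).filter (· < w)).card
        = -((-1 : ℤ) ^ (F.filter (· < w)).card * (-1) ^ ((F.erase w).filter (· < v)).card) := by
    intro v w hv hw hvw
    have h1 : (F.erase w).filter (· < v) = F.filter (· < v) := by
      ext u
      simp only [Finset.mem_filter, Finset.mem_erase]
      constructor
      · rintro ⟨⟨_, h⟩, h'⟩; exact ⟨h, h'⟩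
      · rintro ⟨h, h'⟩; exact ⟨⟨(h'.trans hvw).ne, h⟩, h'⟩
    have h2 : ((F.erase v).filter (· < w)).card + 1 = (F.filter (· < w)).card := by
      rw [Finset.filter_erase]
      exact Finset.card_erase_add_one (by simp [hv, hvw])
    rw [h1, ← h2, pow_succ]
    ring
  refine Finset.sum_involution (fun p _ => ⟨p.2, p.1⟩) ?_ ?_ ?_ ?_
  · rintro ⟨v, w⟩ hp
    simp only [Finset.mem_sigma, Finset.mem_erase] at hp
    obtain ⟨hv, hne, hw⟩ := hp
    simp only
    rw [Finset.erase_right_comm (a := w) (b := v), ← add_smul]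
    rcases lt_or_gt_of_ne hne with h | h
    · rw [key w v hw hv h]; simp
    · rw [key v w hv hw h]; simp
  · rintro ⟨v, w⟩ hp _ heq
    simp only [Finset.mem_sigma, Finset.mem_erase] at hp
    simp only [Sigma.mk.injEq, heq_eq_eq] at heq
    exact hp.2.1 heq.1
  · rintro ⟨v, w⟩ hp
    simp only [Finset.mem_sigma, Finset.mem_erase] at hp ⊢
    exact ⟨hp.2.2, hp.2.1.symm, hp.1⟩
  · rintro ⟨v, w⟩ _
    rfl

theorem boundary_mem_chains (Δ : SimplicialComplex V) (k : ℕ) {c : Finset V →₀ ℤ}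
    (hc : c ∈ chains Δ (k + 1)) : boundary c ∈ chains Δ k := by
  rw [boundary, Finsupp.linearCombination_apply, Finsupp.sum]
  refine Submodule.sum_mem _ fun F hF => Submodule.smul_mem _ _ (Submodule.sum_mem _ fun v hv =>
    Submodule.smul_mem _ _ (Finsupp.single_mem_supported ℤ _ ?_))
  obtain ⟨h1, h2⟩ := hc hF
  refine ⟨Δ.lower (Finset.erase_subset v F) h1, ?_⟩
  have := Finset.card_erase_add_one hv
  simp only [dim] at h2 ⊢
  push_cast at h2
  omega

theorem boundary_mem_supported (Δ : SimplicialComplex V) {c : Finset V →₀ ℤ}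
    (hc : c ∈ Finsupp.supported ℤ ℤ {F | F ∈ Δ}) :
    boundary c ∈ Finsupp.supported ℤ ℤ {F | F ∈ Δ} := by
  rw [boundary, Finsupp.linearCombination_apply, Finsupp.sum]
  exact Submodule.sum_mem _ fun F hF => Submodule.smul_mem _ _ (Submodule.sum_mem _ fun v hv =>
    Submodule.smul_mem _ _ (Finsupp.single_mem_supported ℤ _
      (Δ.lower (Finset.erase_subset v F) (hc hF))))

theorem relBoundaries_le_relCycles (Δ B : SimplicialComplex V) (k : ℕ) :
    relBoundaries Δ B k ≤ relCycles Δ B k := by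
  refine sup_le ?_ fun c hc => ⟨?_, ?_⟩
  · rintro _ ⟨c, hc, rfl⟩
    refine ⟨boundary_mem_chains Δ k hc, ?_⟩
    simp only [SetLike.mem_coe, Submodule.mem_comap, boundary_boundary]
    exact Submodule.zero_mem _
  · have hsub : {F | F ∈ Δ ⊓ B ∧ dim F = k} ⊆ {F | F ∈ Δ ∧ dim F = k} :=
      fun F hF => ⟨hF.1.1, hF.2⟩
    exact Finsupp.supported_mono hsub hc
  · have hsub : {F | F ∈ Δ ⊓ B ∧ dim F = k} ⊆ {F | F ∈ Δ ⊓ B} := fun F hF => hF.1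
    exact boundary_mem_supported (Δ ⊓ B) (Finsupp.supported_mono hsub hc)

end Homology

section ProductsOfProjectiveSpaces

variable {r : ℕ} (n : Fin r → ℕ)

/-- The variables `x_{i,j}`, `0 ≤ j ≤ n i`, of the Cox ring of
`ℙ^{n 0} × ⋯ × ℙ^{n (r-1)}`, ordered lexicographically. -/
abbrev CoxVar := Σₗ i : Fin r, Fin (n i + 1)

/-- The irrelevant complex of the product of projective spaces: a simplex is irrelevant when it
contains no variable of one of the factors. -/
def irrelevantComplex : SimplicialComplex (CoxVar n) where
  carrier := {F | ∃ i : Fin r, ∀ v ∈ F, (ofLex v).1 ≠ i}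
  lower' := fun _ _ h ⟨i, hi⟩ => ⟨i, fun v hv => hi v (h hv)⟩

/-- The irrelevant ideal `⋂ i, ⟨x_{i,0}, …, x_{i,n i}⟩` of the Cox ring. -/
noncomputable def irrelevantIdeal (K : Type*) [Field K] : Ideal (MvPolynomial (CoxVar n) K) :=
  ⨅ i : Fin r, Ideal.span (MvPolynomial.X '' {v | (ofLex v).1 = i})

/-- The Stanley-Reisner ideal of a complex, generated by the square-free monomials of its
nonfaces. -/
noncomputable def stanleyReisnerIdeal {V : Type*} (K : Type*) [Field K] (Δ : SimplicialComplex V) :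
    Ideal (MvPolynomial V K) :=
  Ideal.span ((fun F : Finset V => ∏ v ∈ F, MvPolynomial.X v) '' {F | F ∉ Δ})

/-- The irrelevant complex is the complex whose Stanley-Reisner ideal is the irrelevant ideal. -/
theorem stanleyReisnerIdeal_irrelevantComplex (K : Type*) [Field K] :
    stanleyReisnerIdeal K (irrelevantComplex n) = irrelevantIdeal n K := by
  apply le_antisymm
  · rw [stanleyReisnerIdeal, Ideal.span_le]
    rintro _ ⟨F, hF, rfl⟩
    simp only [irrelevantIdeal, SetLike.mem_coe, Ideal.mem_iInf]
    intro i
    have : ∃ v ∈ F, (ofLex v).1 = i := by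
      by_contra! h
      exact hF ⟨i, h⟩
    obtain ⟨v, hv, hi⟩ := this
    exact Ideal.mem_of_dvd _ (Finset.dvd_prod_of_mem _ hv)
      (Ideal.subset_span (Set.mem_image_of_mem _ hi))
  · intro p hp
    rw [p.as_sum]
    refine Ideal.sum_mem _ fun m hm => ?_
    have hF : m.support ∉ irrelevantComplex n := by
      rintro ⟨i, hi⟩
      have h := (Ideal.mem_iInf.1 hp) i
      rw [MvPolynomial.mem_ideal_span_X_image] at h
      obtain ⟨v, hv, hne⟩ := h m hm
      exact hi v (Finsupp.mem_support_iff.2 hne) hv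
    refine Ideal.mem_of_dvd _ ?_ (Ideal.subset_span (Set.mem_image_of_mem _ hF))
    rw [MvPolynomial.monomial_eq, Finsupp.prod]
    exact Dvd.dvd.mul_left (Finset.prod_dvd_prod_of_dvd _ _ fun v hv =>
      dvd_pow_self _ (Finsupp.mem_support_iff.1 hv)) _

end ProductsOfProjectiveSpaces

end VirtualShelling

/-!
Each factor of the product contributes a vertex to every relevant simplex, so a relevant simplex has
at least `r` vertices, and a facet, having `r + 1`, carries exactly two vertices of one factor and
one of each other factor. Hence it has at most two relevant ridges, obtained by deleting one of
these two vertices; they are consecutive in the order, so that modulo irrelevant simplices the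
boundary of the facet is, up to sign, the difference of the two ridges. The facets are thus the
edges of a graph on the relevant ridges; its incidence vectors are linearly independent because the
top relative homology vanishes, which makes it a forest, and a tree by relevant-connectedness.

List the edges of this tree so that each one but the first meets an earlier one. It then meets the
earlier ones in one end only, so a facet has a single relevant intersection with the earlier facets.
Gluing every facet to one earlier facet containing that intersection, and to nothing else, yields a
shelled complex which maps to `Δ` and differs from it over irrelevant simplices only.
-/

namespace VirtualShelling

section ConnectedEnumeration

theorem exists_enumeration_adj_lt {α : Type*} [Finite α] {G : SimpleGraph α}
    (hG : G.Preconnected) :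
    ∃ (N : ℕ) (f : Fin N ≃ α), ∀ i, (∃ j, j < i) → ∃ j < i, G.Adj (f j) (f i) := by
  rcases isEmpty_or_nonempty α with _ | ⟨⟨root⟩⟩
  · exact ⟨0, .equivOfIsEmpty _ _, fun i => i.elim0⟩
  -- Sort by the distance to `root`: a geodesic to `root` starts with a step to an earlier vertex.
  let e := (Finite.equivFin α).symm
  let σ := Tuple.sort fun i => G.dist (e i) root
  let f := σ.trans e
  have hmono : Monotone fun i => G.dist (f i) root :=
    Tuple.monotone_sort fun i => G.dist (e i) root
  refine ⟨_, f, fun i ⟨j, hji⟩ => ?_⟩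
  obtain ⟨path, hpath⟩ := (hG (f i) root).exists_walk_length_eq_dist
  have hne : f i ≠ root := by
    intro hi
    have hj : G.dist (f j) root ≤ G.dist (f i) root := hmono hji.le
    rw [hi, SimpleGraph.dist_self, Nat.le_zero, (hG _ _).dist_eq_zero_iff, ← hi] at hj
    exact hji.ne (f.injective hj)
  generalize hx : f i = x at path hpath hne
  cases path with
  | nil => exact absurd rfl hne
  | @cons _ y _ hadj tail =>
    have hlt : G.dist (f (f.symm y)) root < G.dist (f i) root := by
      rw [f.apply_symm_apply, hx, ← hpath, SimpleGraph.Walk.length_cons]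
      exact Nat.lt_succ_of_le (SimpleGraph.dist_le tail)
    exact ⟨f.symm y, hmono.reflect_lt hlt, by simpa [hx] using hadj.symm⟩

end ConnectedEnumeration

section IncidenceVectors

open Submodule

variable {R M ι α : Type*} [Ring R] [AddCommGroup M] [Module R M] [LinearOrder ι]
  [WellFoundedLT ι] {v : ι → M} {e : α → M} {ends : ι → Set α}

theorem smodEq_span_of_connected
    (hv : ∀ i, ∀ a ∈ ends i, ∀ b ∈ ends i, a ≠ b → v i = e a - e b ∨ v i = e b - e a)
    (hconn : ∀ i, (∃ j, j < i) → ∃ j < i, (ends j ∩ ends i).Nonempty)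
    {i j k : ι} (hj : j ≤ i) (hk : k ≤ i) {a b : α} (ha : a ∈ ends j) (hb : b ∈ ends k) :
    e a ≡ e b [SMOD span R (v '' Set.Iic i)] := by
  induction i using WellFoundedLT.induction generalizing j k a b with
  | ind i ih =>
    have hlt {j k a b} (hj : j < i) (hk : k < i) (ha : a ∈ ends j) (hb : b ∈ ends k) :
        e a ≡ e b [SMOD span R (v '' Set.Iic i)] :=
      (ih (max j k) (max_lt hj hk) (le_max_left _ _) (le_max_right _ _) ha hb).mono
        (span_mono (Set.image_mono (Set.Iic_subset_Iic.2 (max_lt hj hk).le)))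
    have hself {a b} (ha : a ∈ ends i) (hb : b ∈ ends i) :
        e a ≡ e b [SMOD span R (v '' Set.Iic i)] := by
      rcases eq_or_ne a b with rfl | hab
      · rfl
      have hmem : v i ∈ span R (v '' Set.Iic i) :=
        subset_span (Set.mem_image_of_mem v Set.self_mem_Iic)
      rcases hv i a ha b hb hab with h | h <;> rw [h] at hmem
      · exact SModEq.sub_mem.2 hmem
      · exact (SModEq.sub_mem.2 hmem).symm
    have hlast {j a b} (hj : j < i) (ha : a ∈ ends j) (hb : b ∈ ends i) :
        e a ≡ e b [SMOD span R (v '' Set.Iic i)] := by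
      obtain ⟨l, hl, c, hcl, hci⟩ := hconn i ⟨j, hj⟩
      exact (hlt hj hl ha hcl).trans (hself hci hb)
    rcases hj.eq_or_lt with rfl | hj <;> rcases hk.eq_or_lt with rfl | hk
    · exact hself ha hb
    · exact (hlast hk hb ha).symm
    · exact hlast hj ha hb
    · exact hlt hj hk ha hb

theorem eq_of_linearIndependent_of_connected [Nontrivial R] (hindep : LinearIndependent R v)
    (hv : ∀ i, ∀ a ∈ ends i, ∀ b ∈ ends i, a ≠ b → v i = e a - e b ∨ v i = e b - e a)
    (hconn : ∀ i, (∃ j, j < i) → ∃ j < i, (ends j ∩ ends i).Nonempty)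
    {i j k : ι} (hj : j < i) (hk : k < i) {a b : α} (ha : a ∈ ends j ∩ ends i)
    (hb : b ∈ ends k ∩ ends i) : a = b := by
  by_contra hab
  have hle : span R (v '' Set.Iic (max j k)) ≤ span R (v '' Set.Iio i) :=
    span_mono (Set.image_mono (Set.Iic_subset_Iio.2 (max_lt hj hk)))
  have hmod : e a ≡ e b [SMOD span R (v '' Set.Iio i)] :=
    (smodEq_span_of_connected hv hconn (le_max_left j k) (le_max_right j k) ha.1 hb.1).mono hle
  have hmem : v i ∈ span R (v '' Set.Iio i) := by
    rcases hv i a ha.2 b hb.2 hab with h | h <;> rw [h]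
    · exact SModEq.sub_mem.1 hmod
    · exact SModEq.sub_mem.1 hmod.symm
  exact hindep.notMem_span_image Set.self_notMem_Iio hmem

end IncidenceVectors

section Facets

variable {V : Type*} {Δ B : SimplicialComplex V} {F G : Finset V} {d : ℤ}

theorem exists_isFacet_superset [Finite V] (hF : F ∈ Δ) : ∃ G, IsFacet Δ G ∧ F ⊆ G := by
  obtain ⟨G, hFG, hG⟩ := (Set.toFinite {F | F ∈ Δ}).exists_le_maximal hF
  exact ⟨G, hG, hFG⟩

theorem IsFacetOrdering.isFacet {N : ℕ} {F : Fin N → Finset V} (hF : IsFacetOrdering Δ F)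
    (i : Fin N) : IsFacet Δ (F i) :=
  hF.2.subset (Set.mem_range_self i)

theorem IsFacetOrdering.eq_of_subset {N : ℕ} {F : Fin N → Finset V} (hF : IsFacetOrdering Δ F)
    {i j : Fin N} (hij : F i ⊆ F j) : i = j :=
  hF.1 (hij.antisymm ((hF.isFacet i).2 (hF.isFacet j).1 hij))

theorem isFacetOrdering_coe_equiv {N : ℕ} (f : Fin N ≃ {F // IsFacet Δ F}) :
    IsFacetOrdering Δ fun i => (f i : Finset V) :=
  ⟨Subtype.val_injective.comp f.injective, by
    rw [← Function.comp_def, EquivLike.range_comp, Subtype.range_coe_subtype]⟩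

theorem IsPureOfDim.dim_le [Finite V] (hΔ : IsPureOfDim Δ d) (hF : F ∈ Δ) : dim F ≤ d := by
  obtain ⟨G, hG, hFG⟩ := exists_isFacet_superset hF
  have hcard := Finset.card_le_card hFG
  rw [← hΔ.2 G hG, dim, dim]
  omega

theorem IsPureOfDim.isFacet_of_dim_eq [Finite V] (hΔ : IsPureOfDim Δ d) (hF : F ∈ Δ)
    (hd : dim F = d) : IsFacet Δ F := by
  obtain ⟨G, hG, hFG⟩ := exists_isFacet_superset hF
  have hdim := hΔ.2 G hG
  simp only [dim] at hd hdim
  rwa [Finset.eq_of_subset_of_card_le hFG (by omega)]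

/-- The dual graph of `Δ` relative to `B`: its vertices are the facets of `Δ`, and two of them are
adjacent when their intersection is relevant. -/
def facetGraph [DecidableEq V] (B Δ : SimplicialComplex V) :
    SimpleGraph {F : Finset V // IsFacet Δ F} :=
  SimpleGraph.fromRel fun F G => (F : Finset V) ∩ G ∉ B

theorem facetGraph_adj [DecidableEq V] {F G : {F : Finset V // IsFacet Δ F}} :
    (facetGraph B Δ).Adj F G ↔ F ≠ G ∧ (F : Finset V) ∩ G ∉ B := by
  rw [facetGraph, SimpleGraph.fromRel_adj, Finset.inter_comm G.1 F.1, or_self]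

theorem RelevantConnected.preconnected_facetGraph [Finite V] [DecidableEq V]
    (hconn : RelevantConnected B Δ) (hrel : ∀ F, IsFacet Δ F → IsRelevantFace B Δ F) :
    (facetGraph B Δ).Preconnected := by
  rintro ⟨F, hF⟩ ⟨G, hG⟩
  have hpath := hconn F G (hrel F hF) (hrel G hG)
  suffices h : ∀ L (hL : IsFacet Δ L), G ⊆ L → (facetGraph B Δ).Reachable ⟨F, hF⟩ ⟨L, hL⟩ from
    h G hG subset_rfl
  clear hG
  induction hpath with
  | refl =>
    intro L hL hFL
    obtain rfl : F = L := hFL.antisymm (hF.2 hL.1 hFL)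
    rfl
  | @tail K M _ hKM ih =>
    intro L hL hML
    obtain ⟨P, hP, hKP⟩ := exists_isFacet_superset hKM.1.1
    have hPL : P ∩ L ∉ B := fun h =>
      hKM.2.2.2 (B.lower (Finset.inter_subset_inter hKP hML) h)
    refine (ih P hP hKP).trans ?_
    by_cases hne : P = L
    · subst hne; rfl
    · exact (facetGraph_adj.2 ⟨fun h => hne (congrArg Subtype.val h), hPL⟩).reachable

end Facets

section Gluing

variable {V : Type*} [DecidableEq V] {N : ℕ}

/-- The index of the facet that introduces the copy of the vertex `v` used by `F i`, when every
facet `F i` is glued to its parent `F (p i)` along their intersection: from `i`, climb along `p` as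
long as `v` lies in the parent. An index `i` with `i ≤ p i` counts as having no parent. -/
def originIndex (F : Fin N → Finset V) (p : Fin N → Fin N) (v : V) (i : Fin N) : Fin N :=
  if p i < i ∧ v ∈ F (p i) then originIndex F p v (p i) else i
termination_by i.val
decreasing_by omega

/-- The copy of a simplex `K ⊆ F i` that lies over the facet `F i` in the glued complex. -/
def liftSimplex (F : Fin N → Finset V) (p : Fin N → Fin N) (i : Fin N) (K : Finset V) :
    Finset (Fin N × V) :=
  K.image fun v => (originIndex F p v i, v)

/-- The complex obtained from disjoint copies of the simplices `F i` by gluing each of them to its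
parent `F (p i)` along their intersection. -/
def gluedComplex (F : Fin N → Finset V) (p : Fin N → Fin N) : SimplicialComplex (Fin N × V) :=
  ⨆ i, LowerSet.Iic (liftSimplex F p i (F i))

variable {F : Fin N → Finset V} {p : Fin N → Fin N} {i j : Fin N} {v : V} {K L : Finset V}
  {G : Finset (Fin N × V)}

theorem originIndex_of_mem (hp : p i < i) (hv : v ∈ F (p i)) :
    originIndex F p v i = originIndex F p v (p i) := by
  rw [originIndex, if_pos ⟨hp, hv⟩]

theorem originIndex_of_notMem (hv : v ∉ F (p i)) : originIndex F p v i = i := by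
  rw [originIndex, if_neg fun h => hv h.2]

theorem originIndex_le (F : Fin N → Finset V) (p : Fin N → Fin N) (v : V) (i : Fin N) :
    originIndex F p v i ≤ i := by
  induction i using WellFoundedLT.induction with
  | ind i ih =>
    rw [originIndex]
    split_ifs with h
    · exact (ih _ h.1).trans h.1.le
    · exact le_rfl

theorem image_snd_liftSimplex (i : Fin N) (K : Finset V) :
    (liftSimplex F p i K).image Prod.snd = K := by
  simp [liftSimplex, Finset.image_image, Function.comp_def]

theorem dim_liftSimplex (i : Fin N) (K : Finset V) : dim (liftSimplex F p i K) = dim K := by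
  rw [dim, dim, liftSimplex, Finset.card_image_of_injective _ fun _ _ h => (Prod.ext_iff.1 h).2]

theorem liftSimplex_mono (h : K ⊆ L) : liftSimplex F p i K ⊆ liftSimplex F p i L :=
  Finset.image_subset_image h

theorem subset_liftSimplex_iff :
    G ⊆ liftSimplex F p i K ↔
      G.image Prod.snd ⊆ K ∧ liftSimplex F p i (G.image Prod.snd) = G := by
  constructor
  · intro h
    refine ⟨(Finset.image_subset_image h).trans (image_snd_liftSimplex i K).subset, ?_⟩
    have hG : ∀ x ∈ G, (originIndex F p x.2 i, x.2) = x := by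
      intro x hx
      obtain ⟨v, -, rfl⟩ := Finset.mem_image.1 (h hx)
      rfl
    rw [liftSimplex, Finset.image_image]
    exact (Finset.image_congr hG).trans Finset.image_id
  · rintro ⟨hK, hG⟩
    exact hG ▸ liftSimplex_mono hK

theorem liftSimplex_parent (hp : p i < i) (hK : K ⊆ F (p i)) :
    liftSimplex F p i K = liftSimplex F p (p i) K :=
  Finset.image_congr fun v hv => by simp only [originIndex_of_mem hp (hK hv)]

theorem liftSimplex_eq_liftSimplex {i j : Fin N}
    (hK : ∀ i j, j < i → K ⊆ F i → K ⊆ F j → p i < i ∧ K ⊆ F (p i))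
    (hi : K ⊆ F i) (hj : K ⊆ F j) : liftSimplex F p i K = liftSimplex F p j K := by
  rcases lt_trichotomy i j with hij | rfl | hji
  · obtain ⟨hlt, hparent⟩ := hK j i hij hj hi
    rw [liftSimplex_parent hlt hparent]
    exact liftSimplex_eq_liftSimplex hK hi hparent
  · rfl
  · obtain ⟨hlt, hparent⟩ := hK i j hji hi hj
    rw [liftSimplex_parent hlt hparent]
    exact liftSimplex_eq_liftSimplex hK hparent hj
termination_by i.val + j.val

theorem mem_gluedComplex : G ∈ gluedComplex F p ↔ ∃ i, G ⊆ liftSimplex F p i (F i) := by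
  simp [gluedComplex]

theorem mem_fiber_gluedComplex :
    G ∈ fiber (gluedComplex F p) Prod.snd K ↔ ∃ i, K ⊆ F i ∧ liftSimplex F p i K = G := by
  constructor
  · rintro ⟨hG, rfl⟩
    exact (mem_gluedComplex.1 hG).imp fun i hi => subset_liftSimplex_iff.1 hi
  · rintro ⟨i, hK, rfl⟩
    exact ⟨mem_gluedComplex.2 ⟨i, liftSimplex_mono hK⟩, image_snd_liftSimplex i K⟩

theorem fiber_gluedComplex_subsingleton
    (hK : ∀ i j, j < i → K ⊆ F i → K ⊆ F j → p i < i ∧ K ⊆ F (p i)) :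
    (fiber (gluedComplex F p) Prod.snd K).Subsingleton := by
  intro G hG H hH
  obtain ⟨i, hi, rfl⟩ := mem_fiber_gluedComplex.1 hG
  obtain ⟨j, hj, rfl⟩ := mem_fiber_gluedComplex.1 hH
  exact liftSimplex_eq_liftSimplex hK hi hj

theorem fiber_gluedComplex_eq_singleton (hF : ∀ j, F i ⊆ F j → i = j) :
    fiber (gluedComplex F p) Prod.snd (F i) = {liftSimplex F p i (F i)} := by
  ext G
  rw [mem_fiber_gluedComplex, Set.mem_singleton_iff]
  constructor
  · rintro ⟨j, hij, rfl⟩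
    rw [hF j hij]
  · rintro rfl
    exact ⟨i, subset_rfl, rfl⟩

theorem isSurjectiveSimplicialMap_snd {Δ : SimplicialComplex V}
    (hΔ : ∀ K, K ∈ Δ ↔ ∃ i, K ⊆ F i) :
    IsSurjectiveSimplicialMap (gluedComplex F p) Δ Prod.snd := by
  constructor
  · intro G hG
    obtain ⟨i, hi⟩ := mem_gluedComplex.1 hG
    exact (hΔ _).2 ⟨i, (subset_liftSimplex_iff.1 hi).1⟩
  · intro K hK
    obtain ⟨i, hi⟩ := (hΔ K).1 hK
    exact ⟨_, mem_fiber_gluedComplex.2 ⟨i, hi, rfl⟩⟩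

theorem dim_image_snd (hG : G ∈ gluedComplex F p) : dim (G.image Prod.snd) = dim G := by
  obtain ⟨i, hi⟩ := mem_gluedComplex.1 hG
  rw [← dim_liftSimplex (F := F) (p := p) i, (subset_liftSimplex_iff.1 hi).2]

theorem isFacetOrdering_liftSimplex (hF : ∀ i j, F i ⊆ F j → i = j) :
    IsFacetOrdering (gluedComplex F p) fun i => liftSimplex F p i (F i) := by
  have heq : ∀ i j, liftSimplex F p i (F i) ⊆ liftSimplex F p j (F j) → i = j := fun i j h =>
    hF i j (image_snd_liftSimplex (F := F) (p := p) i (F i) ▸ (subset_liftSimplex_iff.1 h).1)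
  refine ⟨fun i j h => heq i j h.subset, Set.Subset.antisymm ?_ ?_⟩
  · rintro _ ⟨i, rfl⟩
    refine ⟨mem_gluedComplex.2 ⟨i, subset_rfl⟩, fun H hH hle => ?_⟩
    obtain ⟨j, hj⟩ := mem_gluedComplex.1 hH
    obtain rfl := heq i j (hle.trans hj)
    exact hj
  · rintro G ⟨hG, hmax⟩
    obtain ⟨i, hi⟩ := mem_gluedComplex.1 hG
    exact ⟨i, (hmax (mem_gluedComplex.2 ⟨i, subset_rfl⟩) hi).antisymm hi⟩

theorem Iic_liftSimplex_inf_iSup (hp : p i < i) :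
    LowerSet.Iic (liftSimplex F p i (F i)) ⊓
        ⨆ j : {j : Fin N // j < i}, LowerSet.Iic (liftSimplex F p j (F j)) =
      LowerSet.Iic (liftSimplex F p i (F i ∩ F (p i))) := by
  ext G
  simp only [LowerSet.coe_inf, LowerSet.coe_iSup, Set.mem_inter_iff, Set.mem_iUnion,
    LowerSet.coe_Iic, Set.mem_Iic]
  constructor
  · rintro ⟨hG, ⟨j, hji⟩, hGj⟩ x hx
    obtain ⟨v, hv, rfl⟩ := Finset.mem_image.1 (hG hx)
    refine Finset.mem_image_of_mem _ (Finset.mem_inter.2 ⟨hv, ?_⟩)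
    by_contra hvp
    -- The copy of `v` is new at `i`, whereas the vertices of the `j`-th facet have origin `≤ j`.
    obtain ⟨w, -, hw⟩ := Finset.mem_image.1 (hGj hx)
    have hij : originIndex F p w j = i :=
      (congrArg Prod.fst hw).trans (originIndex_of_notMem hvp)
    exact hji.not_ge (hij ▸ originIndex_le F p w j)
  · intro hG
    refine ⟨hG.trans (liftSimplex_mono Finset.inter_subset_left), ⟨p i, hp⟩, ?_⟩
    rw [liftSimplex_parent hp Finset.inter_subset_right] at hG
    exact hG.trans (liftSimplex_mono Finset.inter_subset_right)

theorem isPureOfDim_Iic {W : Type*} (G : Finset W) : IsPureOfDim (LowerSet.Iic G) (dim G) :=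
  have hG : G ∈ LowerSet.Iic G := LowerSet.mem_Iic_iff.2 le_rfl
  ⟨⟨G, hG⟩, fun _ hH => congrArg dim (hH.eq_of_le hG hH.1)⟩

theorem isShelling_liftSimplex (hF : ∀ i j, F i ⊆ F j → i = j)
    (hdim : ∀ i j, dim (F i) = dim (F j))
    (hp : ∀ i, (∃ j, j < i) → p i < i ∧ dim (F i ∩ F (p i)) = dim (F i) - 1) :
    IsShelling (gluedComplex F p) fun i => liftSimplex F p i (F i) := by
  have hord := isFacetOrdering_liftSimplex (p := p) hF
  refine ⟨fun G H hG hH => ?_, hord, fun i hi => ?_⟩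
  · obtain ⟨i, rfl⟩ := hord.2.superset hG
    obtain ⟨j, rfl⟩ := hord.2.superset hH
    simpa only [dim_liftSimplex] using hdim i j
  · obtain ⟨hlt, hinter⟩ := hp i hi
    simp only [Iic_liftSimplex_inf_iSup hlt, dim_liftSimplex, ← hinter]
    simpa only [dim_liftSimplex] using isPureOfDim_Iic (liftSimplex F p i (F i ∩ F (p i)))

theorem isVirtualShellingOrder_of_exists_parent {V : Type} [Finite V] [DecidableEq V]
    {B Δ : SimplicialComplex V} {d : ℤ} {F : Fin N → Finset V} (hF : IsFacetOrdering Δ F)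
    (hΔ : IsPureOfDim Δ d)
    (hparent : ∀ i, (∃ j, j < i) → ∃ q < i, dim (F i ∩ F q) = d - 1 ∧
      ∀ j < i, F i ∩ F j ∉ B → F i ∩ F j ⊆ F q) :
    IsVirtualShellingOrder B Δ F := by
  have hdim : ∀ i, dim (F i) = d := fun i => hΔ.2 _ (hF.isFacet i)
  have hmem : ∀ K, K ∈ Δ ↔ ∃ i, K ⊆ F i := by
    refine fun K => ⟨fun hK => ?_, fun ⟨i, hi⟩ => Δ.lower hi (hF.isFacet i).1⟩
    obtain ⟨L, hL, hKL⟩ := exists_isFacet_superset hK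
    obtain ⟨i, rfl⟩ := hF.2.superset hL
    exact ⟨i, hKL⟩
  choose! p hlt hcodim hsub using hparent
  have hfiber := fun i => fiber_gluedComplex_eq_singleton (p := p) (i := i)
    fun _ => hF.eq_of_subset
  refine ⟨hF, Fin N × V, inferInstance, gluedComplex F p, Prod.snd,
    isSurjectiveSimplicialMap_snd hmem,
    ⟨fun i => liftSimplex F p i (F i), fun i => hfiber i ▸ rfl,
      isShelling_liftSimplex (fun _ _ => hF.eq_of_subset)
        (fun i j => (hdim i).trans (hdim j).symm)
        fun i hi => ⟨hlt i hi, hdim i ▸ hcodim i hi⟩⟩,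
    fun _ => dim_image_snd, ?_, fun i => by rw [hfiber, Set.encard_singleton]⟩
  rintro K ⟨-, hK⟩
  by_contra hKB
  refine hK.not_ge (Set.encard_le_one_iff_subsingleton.2
    (fiber_gluedComplex_subsingleton fun i j hji hi hj => ?_))
  have hKij : K ⊆ F i ∩ F j := Finset.subset_inter hi hj
  exact ⟨hlt i ⟨j, hji⟩,
    hKij.trans (hsub i ⟨j, hji⟩ j hji fun h => hKB (B.lower hKij h))⟩

end Gluing

section RelativeBoundary

variable {V : Type*} {B Δ : SimplicialComplex V} {F : Finset V} {k : ℕ}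

/-- The chains relative to `B`: the free abelian group on all simplices modulo those in `B`. -/
abbrev RelChains (B : SimplicialComplex V) : Type _ :=
  (Finset V →₀ ℤ) ⧸ Finsupp.supported ℤ ℤ {F | F ∈ B}

/-- The generator of the relative chains given by a simplex. -/
noncomputable def simplexClass (B : SimplicialComplex V) (F : Finset V) : RelChains B :=
  Submodule.Quotient.mk (Finsupp.single F 1)

theorem simplexClass_eq_zero (hF : F ∈ B) : simplexClass B F = 0 :=
  (Submodule.Quotient.mk_eq_zero _).2 (Finsupp.single_mem_supported ℤ 1 hF)

/-- The codimension one faces of `F` that do not lie in `B`. -/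
def relevantRidges (B : SimplicialComplex V) (F : Finset V) : Set (Finset V) :=
  {R | R ∉ B ∧ R ⋖ F}

theorem chains_eq_bot (h : ∀ F ∈ Δ, dim F ≠ k) : chains Δ k = ⊥ := by
  have hempty : {F | F ∈ Δ ∧ dim F = k} = ∅ :=
    Set.eq_empty_of_forall_notMem fun F hF => h F hF.1 hF.2
  rw [chains, hempty, Finsupp.supported_empty]

variable [LinearOrder V]

/-- The boundary of a chain as a chain relative to `B`; the relative cycles of `(Δ, Δ ∩ B)` are the
chains of `Δ` in its kernel. -/
noncomputable def relBoundary (B : SimplicialComplex V) : (Finset V →₀ ℤ) →ₗ[ℤ] RelChains B :=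
  Submodule.mkQ _ ∘ₗ boundary

theorem relBoundary_single (F : Finset V) :
    relBoundary B (Finsupp.single F 1) =
      ∑ v ∈ F, (-1 : ℤ) ^ (F.filter (· < v)).card • simplexClass B (F.erase v) := by
  simp only [relBoundary, LinearMap.comp_apply, boundary_single, map_sum, map_smul,
    Submodule.mkQ_apply, simplexClass]

theorem card_filter_lt_eq_add_one {a b : V} (ha : a ∈ F) (hab : a < b)
    (hbetween : ∀ c ∈ F, a < c → ¬ c < b) :
    (F.filter (· < b)).card = (F.filter (· < a)).card + 1 := by
  have hinsert : F.filter (· < b) = insert a (F.filter (· < a)) := by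
    ext c
    simp only [Finset.mem_filter, Finset.mem_insert]
    constructor
    · rintro ⟨hc, hcb⟩
      exact (not_lt.1 fun hac => hbetween c hc hac hcb).eq_or_lt.imp_right fun hca => ⟨hc, hca⟩
    · rintro (rfl | ⟨hc, hca⟩)
      exacts [⟨ha, hab⟩, ⟨hc, hca.trans hab⟩]
  rw [hinsert, Finset.card_insert_of_notMem (by simp)]

theorem relBoundary_single_eq_sub_or_sub {a b : V} (ha : a ∈ F) (hb : b ∈ F) (hab : a < b)
    (hbetween : ∀ c ∈ F, a < c → ¬ c < b) (hB : ∀ c ∈ F, F.erase c ∉ B → c = a ∨ c = b) :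
    relBoundary B (Finsupp.single F 1) =
        simplexClass B (F.erase a) - simplexClass B (F.erase b) ∨
      relBoundary B (Finsupp.single F 1) =
        simplexClass B (F.erase b) - simplexClass B (F.erase a) := by
  have hother : ∀ c ∈ F, c ≠ a ∧ c ≠ b →
      (-1 : ℤ) ^ (F.filter (· < c)).card • simplexClass B (F.erase c) = 0 := by
    intro c hc hne
    have hFc : F.erase c ∈ B := by
      by_contra hFc
      exact (hB c hc hFc).elim hne.1 hne.2
    rw [simplexClass_eq_zero hFc, smul_zero]
  rw [relBoundary_single, Finset.sum_eq_add_of_mem a b ha hb hab.ne hother,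
    card_filter_lt_eq_add_one ha hab hbetween, pow_succ]
  rcases neg_one_pow_eq_or ℤ (F.filter (· < a)).card with hsign | hsign <;> rw [hsign]
  · exact .inl (by module)
  · exact .inr (by module)

theorem relBoundaries_eq_bot [Finite V] (hpure : IsPureOfDim Δ k) (hB : ∀ F, IsFacet Δ F → F ∉ B) :
    relBoundaries Δ B k = ⊥ := by
  have hsucc : chains Δ (k + 1) = ⊥ := chains_eq_bot fun F hF hdim => by
    have hle := hpure.dim_le hF
    omega
  have hinter : chains (Δ ⊓ B) k = ⊥ := chains_eq_bot fun F hF hdim =>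
    hB F (hpure.isFacet_of_dim_eq hF.1 hdim) hF.2
  rw [relBoundaries, hsucc, hinter, Submodule.map_bot, sup_bot_eq]

theorem relCycles_eq_bot [Finite V] (hpure : IsPureOfDim Δ k) (hB : ∀ F, IsFacet Δ F → F ∉ B)
    (hH : Subsingleton (RelHomology Δ B k)) : relCycles Δ B k = ⊥ :=
  le_bot_iff.1 (relBoundaries_eq_bot hpure hB ▸
    Submodule.submoduleOf_eq_top.1 (Submodule.Quotient.subsingleton_iff.1 hH))

theorem mem_relCycles {c : Finset V →₀ ℤ} (hc : c ∈ chains Δ k) (hzero : relBoundary B c = 0) :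
    c ∈ relCycles Δ B k := by
  have hΔ : boundary c ∈ Finsupp.supported ℤ ℤ {F | F ∈ Δ} :=
    boundary_mem_supported Δ (Finsupp.supported_mono (fun _ hF => hF.1) hc)
  have hB : boundary c ∈ Finsupp.supported ℤ ℤ {F | F ∈ B} :=
    (Submodule.Quotient.mk_eq_zero _).1 hzero
  have hinter : boundary c ∈ Finsupp.supported ℤ ℤ {F | F ∈ Δ ⊓ B} :=
    fun F hF => ⟨hΔ hF, hB hF⟩
  exact ⟨hc, hinter⟩

theorem linearIndependent_relBoundary [Finite V] (hpure : IsPureOfDim Δ k)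
    (hB : ∀ F, IsFacet Δ F → F ∉ B) (hH : Subsingleton (RelHomology Δ B k)) :
    LinearIndependent ℤ fun F : {F // IsFacet Δ F} =>
      relBoundary B (Finsupp.single (F : Finset V) 1) := by
  suffices h : LinearIndepOn ℤ (fun F => relBoundary B (Finsupp.single F 1))
      {F | IsFacet Δ F} from h
  refine linearIndepOn_iff.2 fun c hc hzero => ?_
  have hfacets : {F | IsFacet Δ F} ⊆ {F | F ∈ Δ ∧ dim F = k} := fun F hF =>
    ⟨hF.1, hpure.2 F hF⟩
  have hchain : c ∈ chains Δ k := Finsupp.supported_mono hfacets hc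
  have hboundary : relBoundary B c = 0 := by
    rw [← hzero, Finsupp.linearCombination_apply]
    conv_lhs => rw [← Finsupp.sum_single c, map_finsuppSum]
    exact Finsupp.sum_congr fun F _ => by rw [← map_smul, Finsupp.smul_single_one]
  exact (Submodule.mem_bot ℤ).1
    (relCycles_eq_bot hpure hB hH ▸ mem_relCycles hchain hboundary)

end RelativeBoundary

section RelevantRidges

variable {r : ℕ} {n : Fin r → ℕ} {F G R R' : Finset (CoxVar n)} {a b c : CoxVar n}

/-- The index of the projective space that a variable of the Cox ring comes from. -/
def factor (v : CoxVar n) : Fin r := (ofLex v).1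

theorem factor_mono : Monotone (factor : CoxVar n → Fin r) := fun _ _ h =>
  (Sigma.Lex.le_def.1 h).elim le_of_lt fun ⟨heq, _⟩ => heq.le

theorem notMem_irrelevantComplex_iff :
    F ∉ irrelevantComplex n ↔ ∀ i, ∃ v ∈ F, factor v = i := by
  change ¬(∃ i : Fin r, ∀ v ∈ F, factor v ≠ i) ↔ _
  push Not
  rfl

theorem image_factor (hF : F ∉ irrelevantComplex n) : F.image factor = Finset.univ := by
  ext i
  simpa using notMem_irrelevantComplex_iff.1 hF i

theorem le_card_of_notMem_irrelevantComplex (hF : F ∉ irrelevantComplex n) : r ≤ F.card := by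
  simpa [image_factor hF] using Finset.card_image_le (s := F) (f := factor)

theorem factor_injOn (hF : F ∉ irrelevantComplex n) (hcard : F.card = r) :
    Set.InjOn factor (F : Set (CoxVar n)) :=
  Finset.card_image_iff.1 (by rw [image_factor hF, Finset.card_univ, Fintype.card_fin, hcard])

theorem eq_or_eq_of_erase_notMem (hcard : F.card = r + 1) (ha : a ∈ F) (hb : b ∈ F) (hab : a ≠ b)
    (hfactor : factor a = factor b) (hc : c ∈ F) (hFc : F.erase c ∉ irrelevantComplex n) :
    c = a ∨ c = b := by
  by_contra! hne
  have hcard' : (F.erase c).card = r := by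
    rw [Finset.card_erase_of_mem hc, hcard, Nat.add_sub_cancel]
  exact hab (factor_injOn hFc hcard' (Finset.mem_coe.2 (Finset.mem_erase.2 ⟨hne.1.symm, ha⟩))
    (Finset.mem_coe.2 (Finset.mem_erase.2 ⟨hne.2.symm, hb⟩)) hfactor)

theorem factor_eq_of_erase_notMem (hcard : F.card = r + 1) (ha : a ∈ F) (hb : b ∈ F)
    (hFa : F.erase a ∉ irrelevantComplex n) (hFb : F.erase b ∉ irrelevantComplex n) :
    factor a = factor b := by
  obtain ⟨w, hw, hwa⟩ := notMem_irrelevantComplex_iff.1 hFa (factor a)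
  obtain ⟨hne, hwF⟩ := Finset.mem_erase.1 hw
  rcases eq_or_eq_of_erase_notMem hcard hwF ha hne hwa hb hFb with rfl | rfl
  · exact hwa.symm
  · rfl

theorem erase_notMem_of_factor_eq (hF : F ∉ irrelevantComplex n) (hb : b ∈ F) (hab : a ≠ b)
    (hfactor : factor a = factor b) : F.erase a ∉ irrelevantComplex n := by
  rw [notMem_irrelevantComplex_iff] at hF ⊢
  intro i
  obtain ⟨w, hw, rfl⟩ := hF i
  rcases eq_or_ne w a with rfl | hwa
  · exact ⟨b, Finset.mem_erase.2 ⟨hab.symm, hb⟩, hfactor.symm⟩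
  · exact ⟨w, Finset.mem_erase.2 ⟨hwa, hw⟩, rfl⟩

theorem not_lt_of_factor_eq (hF : F ∉ irrelevantComplex n) (hcard : F.card = r + 1)
    (ha : a ∈ F) (hb : b ∈ F) (hab : a < b) (hfactor : factor a = factor b) (hc : c ∈ F)
    (hac : a < c) : ¬ c < b := by
  intro hcb
  have hfactor' : factor a = factor c :=
    (factor_mono hac.le).antisymm (hfactor ▸ factor_mono hcb.le)
  rcases eq_or_eq_of_erase_notMem hcard ha hc hac.ne hfactor' hb
    (erase_notMem_of_factor_eq hF ha hab.ne' hfactor.symm) with rfl | rfl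
  · exact hab.false
  · exact hcb.false

theorem relBoundary_single_eq_sub_or_sub_of_mem_relevantRidges (hcard : F.card = r + 1)
    (hR : R ∈ relevantRidges (irrelevantComplex n) F)
    (hR' : R' ∈ relevantRidges (irrelevantComplex n) F) (hne : R ≠ R') :
    relBoundary (irrelevantComplex n) (Finsupp.single F 1) =
        simplexClass (irrelevantComplex n) R - simplexClass (irrelevantComplex n) R' ∨
      relBoundary (irrelevantComplex n) (Finsupp.single F 1) =
        simplexClass (irrelevantComplex n) R' - simplexClass (irrelevantComplex n) R := by
  obtain ⟨hRrel, hRF⟩ := hR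
  obtain ⟨hRrel', hRF'⟩ := hR'
  have hF : F ∉ irrelevantComplex n := fun h => hRrel ((irrelevantComplex n).lower hRF.le h)
  obtain ⟨a, ha, rfl⟩ := Finset.covBy_iff_exists_erase.1 hRF
  obtain ⟨b, hb, rfl⟩ := Finset.covBy_iff_exists_erase.1 hRF'
  have hfactor := factor_eq_of_erase_notMem hcard ha hb hRrel hRrel'
  wlog hab : a < b generalizing a b
  · have hba : b < a := lt_of_le_of_ne (not_lt.1 hab) fun h => hne (h ▸ rfl)
    exact (this b hb hRrel' hRF' a ha hRrel hRF hne.symm hfactor.symm hba).symm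
  exact relBoundary_single_eq_sub_or_sub ha hb hab
    (fun c hc hac => not_lt_of_factor_eq hF hcard ha hb hab hfactor hc hac)
    fun c hc hFc => eq_or_eq_of_erase_notMem hcard ha hb hab.ne hfactor hc hFc

theorem card_inter_eq (hF : F.card = r + 1) (hG : G.card = r + 1) (hne : F ≠ G)
    (hFG : F ∩ G ∉ irrelevantComplex n) : (F ∩ G).card = r := by
  have hlt : (F ∩ G).card < F.card := by
    refine Finset.card_lt_card (Finset.inter_subset_left.ssubset_of_ne fun h => hne ?_)
    exact Finset.eq_of_subset_of_card_le (Finset.inter_eq_left.1 h) (hG.trans hF.symm).le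
  have hle := le_card_of_notMem_irrelevantComplex hFG
  omega

theorem inter_mem_relevantRidges (hF : F.card = r + 1) (hG : G.card = r + 1) (hne : F ≠ G)
    (hFG : F ∩ G ∉ irrelevantComplex n) :
    F ∩ G ∈ relevantRidges (irrelevantComplex n) F := by
  refine ⟨hFG, Finset.covBy_iff_card_sdiff_eq_one.2 ⟨Finset.inter_subset_left, ?_⟩⟩
  have hcard := card_inter_eq hF hG hne hFG
  rw [Finset.card_sdiff_of_subset Finset.inter_subset_left]
  omega

end RelevantRidges

section Trees

variable {r : ℕ} {n : Fin r → ℕ} {Δ : SimplicialComplex (CoxVar n)}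

theorem card_of_isFacet (hpure : IsPureOfDim Δ r) {F : Finset (CoxVar n)} (hF : IsFacet Δ F) :
    F.card = r + 1 := by
  have hdim := hpure.2 F hF
  simp only [dim] at hdim
  omega

theorem dim_inter_of_adj (hpure : IsPureOfDim Δ r) {F G : {F // IsFacet Δ F}}
    (hadj : (facetGraph (irrelevantComplex n) Δ).Adj F G) :
    dim ((F : Finset (CoxVar n)) ∩ G) = r - 1 := by
  obtain ⟨hne, hFG⟩ := facetGraph_adj.1 hadj
  rw [dim, card_inter_eq (card_of_isFacet hpure F.2) (card_of_isFacet hpure G.2)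
    (fun h => hne (Subtype.ext h)) hFG]

theorem inter_mem_relevantRidges_inter_of_adj (hpure : IsPureOfDim Δ r) {F G : {F // IsFacet Δ F}}
    (hadj : (facetGraph (irrelevantComplex n) Δ).Adj F G) :
    (F : Finset (CoxVar n)) ∩ G ∈ relevantRidges (irrelevantComplex n) F ∩
      relevantRidges (irrelevantComplex n) G := by
  obtain ⟨hne, hFG⟩ := facetGraph_adj.1 hadj
  have hne' : (F : Finset (CoxVar n)) ≠ G := fun h => hne (Subtype.ext h)
  have hF := card_of_isFacet hpure F.2
  have hG := card_of_isFacet hpure G.2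
  refine ⟨inter_mem_relevantRidges hF hG hne' hFG, ?_⟩
  rw [Finset.inter_comm] at hFG ⊢
  exact inter_mem_relevantRidges hG hF hne'.symm hFG

theorem inter_eq_inter_of_adj (hpure : IsPureOfDim Δ r)
    (hrel : ∀ F, IsFacet Δ F → F ∉ irrelevantComplex n)
    (hH : Subsingleton (RelHomology Δ (irrelevantComplex n) r)) {N : ℕ}
    (f : Fin N ≃ {F // IsFacet Δ F})
    (hf : ∀ i, (∃ j, j < i) → ∃ j < i, (facetGraph (irrelevantComplex n) Δ).Adj (f j) (f i))
    {i j k : Fin N} (hj : j < i) (hk : k < i)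
    (hji : (facetGraph (irrelevantComplex n) Δ).Adj (f j) (f i))
    (hki : (facetGraph (irrelevantComplex n) Δ).Adj (f k) (f i)) :
    (f j : Finset (CoxVar n)) ∩ f i = ↑(f k) ∩ ↑(f i) := by
  refine eq_of_linearIndependent_of_connected (e := simplexClass (irrelevantComplex n))
    (ends := fun i => relevantRidges (irrelevantComplex n) (f i))
    ((linearIndependent_relBoundary hpure hrel hH).comp f f.injective)
    (fun i _ hR _ hR' hne => relBoundary_single_eq_sub_or_sub_of_mem_relevantRidges
      (card_of_isFacet hpure (f i).2) hR hR' hne)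
    (fun i hi => ?_) hj hk (inter_mem_relevantRidges_inter_of_adj hpure hji)
    (inter_mem_relevantRidges_inter_of_adj hpure hki)
  obtain ⟨l, hl, hadj⟩ := hf i hi
  exact ⟨l, hl, _, inter_mem_relevantRidges_inter_of_adj hpure hadj⟩

end Trees

end VirtualShelling

open VirtualShelling in
theorem corollary5p2 {r : ℕ} (n : Fin r → ℕ)
    (Δ : VirtualShelling.SimplicialComplex (VirtualShelling.CoxVar n))
    (hpure : VirtualShelling.IsPureOfDim Δ (r : ℤ))
    (hrel : ∀ F, VirtualShelling.IsFacet Δ F →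
      VirtualShelling.IsRelevantFace (VirtualShelling.irrelevantComplex n) Δ F)
    (hconn : VirtualShelling.RelevantConnected (VirtualShelling.irrelevantComplex n) Δ)
    (hH : Subsingleton
      (VirtualShelling.RelHomology Δ (VirtualShelling.irrelevantComplex n) r)) :
    VirtualShelling.IsVirtuallyShellable (VirtualShelling.irrelevantComplex n) Δ := by
  obtain ⟨N, f, hf⟩ := exists_enumeration_adj_lt (hconn.preconnected_facetGraph hrel)
  refine ⟨N, fun i => f i, isVirtualShellingOrder_of_exists_parent (isFacetOrdering_coe_equiv f)
    hpure fun i hi => ?_⟩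
  obtain ⟨q, hq, hadj⟩ := hf i hi
  refine ⟨q, hq, dim_inter_of_adj hpure hadj.symm, fun j hj hij => ?_⟩
  have hadj' : (facetGraph (irrelevantComplex n) Δ).Adj (f i) (f j) :=
    facetGraph_adj.2 ⟨f.injective.ne hj.ne', hij⟩
  have heq := inter_eq_inter_of_adj hpure (fun F hF => (hrel F hF).2) hH f hf hj hq hadj'.symm hadj
  rw [Finset.inter_comm, heq]
  exact Finset.inter_subset_left
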